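/- Throughout, manifolds are paracompact, connected, Hausdorff $C^\infty$ manifolds (without boundary) of one fixed dimension $n$. For $1\le k\le\infty$, a $C^k$ pseudo-Riemannian manifold $(M,g)$ is a manifold $M$ with a $C^k$ symmetric, non-degenerate covariant 2-tensor field $g$, of any signature. A parametrised curve in $M$ is a $C^1$ map $\gamma:[a,b)\to M$, $a<b\le\infty$, with nowhere vanishing tangent vector; its parameter is bounded if $b<\infty$; $p\in M$ is an endpoint of $\gamma$ if $\gamma(t)\to p$ as $t\to b$. Let $\mathcal C_g(M)$ be the family of all parametrised curves in $M$ that are affinely parametrised geodesics of (the Levi-Civita connection of) $g$. $(M,g)$ is $\mathcal C_g(M)$-complete if every curve of $\mathcal C_g(M)$ with bounded parameter has an endpoint in $M$. An envelopment of $M$ is a $C^\infty$ embedding $\phi:M\to\widehat M$ into a manifold $\widehat M$ of the same dimension. Its boundary points are the points of $\overline{\phi(M)}\setminus\phi(M)$. A boundary point $p$ is regular (for the $C^k$ metric $g$) if there are a connected open submanifold $\overline M\subseteq\widehat M$ with $\phi(M)\cup\{p\}\subseteq\overline M$ and a $C^k$ pseudo-Riemannian metric $\bar g$ on $\overline M$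 with $\phi^*\bar g=g$. **Theorem 6.3.** Let $1\le k\le\infty$ and let $(M,g)$ be a $C^k$ pseudo-Riemannian manifold. If $(M,g)$ is $\mathcal C_g(M)$-complete, then no envelopment of $M$ has a regular boundary point. -/

import Mathlib

open Set Topology Manifold Bundle
open scoped ContDiff

noncomputable section

namespace AbstractBoundary

/-- A `C^k` metric on an `n`-dimensional smooth manifold: a symmetric nondegenerate covariant
`2`-tensor field of class `C^k`, of arbitrary signature. -/
structure PseudoRiemannianMetric (n : ℕ) (k : ℕ∞) (M : Type*) [TopologicalSpace M]
    [ChartedSpace (EuclideanSpace ℝ (Fin n)) M] [IsManifold (𝓡 n) ∞ M] where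
  /-- The bilinear form on each tangent space. -/
  inner (x : M) : TangentSpace (𝓡 n) x →L[ℝ] TangentSpace (𝓡 n) x →L[ℝ] ℝ
  symm (x : M) (v w : TangentSpace (𝓡 n) x) : inner x v w = inner x w v
  nondegenerate (x : M) (v : TangentSpace (𝓡 n) x) (hv : ∀ w, inner x v w = 0) : v = 0
  contMDiff : ContMDiff (𝓡 n)
    ((𝓡 n).prod 𝓘(ℝ, EuclideanSpace ℝ (Fin n) →L[ℝ] EuclideanSpace ℝ (Fin n) →L[ℝ] ℝ)) k
    (fun x : M ↦ TotalSpace.mk' (EuclideanSpace ℝ (Fin n) →L[ℝ] EuclideanSpace ℝ (Fin n) →L[ℝ] ℝ)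
      (E := fun x : M ↦ TangentSpace (𝓡 n) x →L[ℝ] TangentSpace (𝓡 n) x →L[ℝ] ℝ) x (inner x))

/-! ### Parametrised curves and completeness -/

/-- The half-open interval `[a, b)` of real numbers, `b ≤ ∞`. -/
def paramInterval (a : ℝ) (b : EReal) : Set ℝ := {t : ℝ | a ≤ t ∧ (t : EReal) < b}

/-- A parametrised curve: a `C^1` map on an interval `[a, b)` with `a < b ≤ ∞` whose tangent
vector vanishes nowhere. Only the values of `toFun` on `[a, b)` matter. -/
structure ParametrisedCurve (n : ℕ) (M : Type*) [TopologicalSpace M]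
    [ChartedSpace (EuclideanSpace ℝ (Fin n)) M] where
  left : ℝ
  right : EReal
  left_lt_right : (left : EReal) < right
  toFun : ℝ → M
  contMDiffOn : ContMDiffOn 𝓘(ℝ, ℝ) (𝓡 n) 1 toFun (paramInterval left right)
  tangent_ne_zero : ∀ t ∈ paramInterval left right,
    mfderivWithin 𝓘(ℝ, ℝ) (𝓡 n) toFun (paramInterval left right) t (1 : ℝ) ≠ 0

namespace ParametrisedCurve

variable {n : ℕ} {M : Type*} [TopologicalSpace M] [ChartedSpace (EuclideanSpace ℝ (Fin n)) M]

/-- The interval of definition `[a, b)` of the curve. -/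
def domain (γ : ParametrisedCurve n M) : Set ℝ := paramInterval γ.left γ.right

/-- The parameter of the curve is bounded: `b < ∞`. -/
def HasBoundedParameter (γ : ParametrisedCurve n M) : Prop := γ.right < ⊤

/-- `p` is an endpoint of `γ`: `γ(t) → p` as `t → b`. -/
def HasEndpoint (γ : ParametrisedCurve n M) (p : M) : Prop :=
  ∀ U ∈ 𝓝 p, ∃ s ∈ γ.domain, ∀ t ∈ γ.domain, s ≤ t → γ.toFun t ∈ U

end ParametrisedCurve

/-- Completeness with respect to a family `C` of parametrised curves: every curve of the family
with bounded parameter has an endpoint in the manifold. -/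
def IsCompleteFor {n : ℕ} {M : Type*} [TopologicalSpace M]
    [ChartedSpace (EuclideanSpace ℝ (Fin n)) M] (C : Set (ParametrisedCurve n M)) : Prop :=
  ∀ γ ∈ C, γ.HasBoundedParameter → ∃ p : M, γ.HasEndpoint p

/-! ### Affinely parametrised geodesics of the Levi-Civita connection -/

/-- The Christoffel symbols of the first kind of a coordinate metric `G = (g_ij)` at `y`, contracted
with vectors: `Γ_{kij} u^i v^j w^k` with
`Γ_{kij} = (∂_i g_{jk} + ∂_j g_{ik} - ∂_k g_{ij}) / 2`. -/
def christoffelFirst {n : ℕ}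
    (G : EuclideanSpace ℝ (Fin n) →
      (EuclideanSpace ℝ (Fin n) →L[ℝ] EuclideanSpace ℝ (Fin n) →L[ℝ] ℝ))
    (y u v w : EuclideanSpace ℝ (Fin n)) : ℝ :=
  (fderiv ℝ G y u v w + fderiv ℝ G y v u w - fderiv ℝ G y w u v) / 2

section Geodesic

variable {n : ℕ} {k : ℕ∞} {M : Type*} [TopologicalSpace M]
  [ChartedSpace (EuclideanSpace ℝ (Fin n)) M] [IsManifold (𝓡 n) ∞ M]

/-- The components of the metric `g` in the chart `e`: the bilinear form-valued function on
`e.target` which is the pullback of `g` under the inverse of the chart. -/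
def PseudoRiemannianMetric.inChart (g : PseudoRiemannianMetric n k M)
    (e : OpenPartialHomeomorph M (EuclideanSpace ℝ (Fin n))) (y : EuclideanSpace ℝ (Fin n)) :
    EuclideanSpace ℝ (Fin n) →L[ℝ] EuclideanSpace ℝ (Fin n) →L[ℝ] ℝ :=
  let B : EuclideanSpace ℝ (Fin n) →L[ℝ] EuclideanSpace ℝ (Fin n) →L[ℝ] ℝ := g.inner (e.symm y)
  let A : EuclideanSpace ℝ (Fin n) →L[ℝ] EuclideanSpace ℝ (Fin n) :=
    mfderiv (𝓡 n) (𝓡 n) e.symm y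
  B.bilinearComp A A

/-- A parametrised curve is an affinely parametrised geodesic of `g` if near each of its parameter
values it lies in a smooth chart in which it is twice differentiable and satisfies the geodesic
equation `g_{kl} x''^l + Γ_{kij} x'^i x'^j = 0`, which is `x''^l + Γ^l_{ij} x'^i x'^j = 0` with the
index lowered. The equation is invariant under smooth changes of chart, so that it then holds in
every smooth chart. Derivatives are one-sided at the initial parameter value. -/
def IsAffineGeodesic (g : PseudoRiemannianMetric n k M) (γ : ParametrisedCurve n M) : Prop :=
  ∀ t₀ ∈ γ.domain, ∃ e ∈ IsManifold.maximalAtlas (𝓡 n) ∞ M, γ.toFun t₀ ∈ e.source ∧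
    ∃ x' x'' : ℝ → EuclideanSpace ℝ (Fin n), ∀ᶠ t in 𝓝[γ.domain] t₀,
      HasDerivWithinAt (fun s ↦ e (γ.toFun s)) (x' t) γ.domain t ∧
      HasDerivWithinAt x' (x'' t) γ.domain t ∧
      ∀ w : EuclideanSpace ℝ (Fin n),
        g.inChart e (e (γ.toFun t)) (x'' t) w
          + christoffelFirst (g.inChart e) (e (γ.toFun t)) (x' t) (x' t) w = 0

/-- The family of all affinely parametrised geodesics of `g`. -/
def affineGeodesics (g : PseudoRiemannianMetric n k M) : Set (ParametrisedCurve n M) :=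
  {γ | IsAffineGeodesic g γ}

end Geodesic

/-! ### Envelopments, extensions and regular boundary points -/

section Envelopment

variable {n : ℕ} {k l : ℕ∞}
  {M : Type*} [TopologicalSpace M] [ChartedSpace (EuclideanSpace ℝ (Fin n)) M]
  {N : Type*} [TopologicalSpace N] [ChartedSpace (EuclideanSpace ℝ (Fin n)) N]

variable (n M N) in
/-- An envelopment of `M` by a manifold `N` of the same dimension `n`: a `C^∞` embedding. -/
structure Envelopment where
  toFun : M → N
  isSmoothEmbedding : IsSmoothEmbedding (𝓡 n) (𝓡 n) ∞ toFun

/-- The boundary points of an envelopment: the closure of the image minus the image. -/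
def Envelopment.boundary (φ : Envelopment n M N) : Set N :=
  closure (range φ.toFun) \ range φ.toFun

variable [IsManifold (𝓡 n) ∞ M] [IsManifold (𝓡 n) ∞ N]

/-- `(N, h)` is an extension of `(M, g)` by the envelopment `φ`: the metric `h` restricts on
`φ(M)` to the metric transported from `g`, that is, `φ^* h = g`. -/
def Envelopment.IsExtension (φ : Envelopment n M N) (g : PseudoRiemannianMetric n k M)
    (h : PseudoRiemannianMetric n l N) : Prop :=
  ∀ (x : M) (v w : TangentSpace (𝓡 n) x),
    h.inner (φ.toFun x) (mfderiv (𝓡 n) (𝓡 n) φ.toFun x v) (mfderiv (𝓡 n) (𝓡 n) φ.toFun x w)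
      = g.inner x v w

/-- A boundary point `p` of the envelopment `φ` is `C^l` regular for `g` if there are a connected
open submanifold `U` of `N` containing `φ(M)` and `p`, and a `C^l` metric on `U`, such that `φ`,
regarded as a map `ψ` into `U`, is an extension of `(M, g)`. -/
def Envelopment.IsRegularBoundaryPoint (φ : Envelopment n M N)
    (g : PseudoRiemannianMetric n k M) (l : ℕ∞) (p : N) : Prop :=
  p ∈ φ.boundary ∧
    ∃ U : TopologicalSpace.Opens N, p ∈ U ∧ IsConnected (U : Set N) ∧
      ∃ ψ : Envelopment n M U, (∀ x, (ψ.toFun x : N) = φ.toFun x) ∧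
        ∃ h : PseudoRiemannianMetric n l U, ψ.IsExtension g h

end Envelopment

end AbstractBoundary

end

open AbstractBoundary

/-! Suppose the metric extends over an open set `U` containing `φ(M)` and a boundary point `p`. In a
chart of `U` at `p`, let `W` be the open set of coordinates of image points; `p` is a limit of `W`
outside it. From a point `q` of `W` close to `p`, take a nearest point `b` of the complement: the
ball about `q` through `b` lies in `W`, while `b` does not (`exists_interior_ball`). The geodesic of
the extended metric issuing from `b` with velocity `q - b` enters this ball at once
(`exists_geodesic_into`). Run backwards, it is a geodesic of `M` with bounded parameter that
converges to `b`, outside `φ(M)`. Completeness gives it a limit in `M` as well, against the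
Hausdorff property (`closure_subset_range`).

A `C^1` metric has merely continuous Christoffel symbols, so the geodesic comes from Peano's
theorem; its uniqueness plays no role. -/

open Filter MeasureTheory
open scoped NNReal

/-! ### Peano's existence theorem by Tonelli's delayed iterates. -/

namespace PeanoODE

variable {E : Type*} [NormedAddCommGroup E] [NormedSpace ℝ E]

/-- The Tonelli iterates for `x' = F x`, `x 0 = x₀`, with delay `δ`. -/
noncomputable def delayIterate (F : E → E) (x₀ : E) (δ : ℝ) : ℕ → ℝ → E
  | 0 => fun _ ↦ x₀
  | j + 1 => fun t ↦ x₀ + ∫ s in (0 : ℝ)..max (t - δ) 0, F (delayIterate F x₀ δ j s)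

theorem norm_integral_sub_le {f : ℝ → E} {L : ℝ≥0} (hf : Continuous f) (hL : ∀ s, ‖f s‖ ≤ L)
    (a b : ℝ) : ‖(∫ s in (0 : ℝ)..a, f s) - ∫ s in (0 : ℝ)..b, f s‖ ≤ L * |a - b| := by
  rw [intervalIntegral.integral_interval_sub_left (hf.intervalIntegrable _ _)
    (hf.intervalIntegrable _ _)]
  exact intervalIntegral.norm_integral_le_of_norm_le_const fun s _ ↦ hL s

theorem delayIterate_lipschitz {F : E → E} (hF : Continuous F) {L : ℝ≥0} (hL : ∀ z, ‖F z‖ ≤ L)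
    (x₀ : E) (δ : ℝ) (j : ℕ) : LipschitzWith L (delayIterate F x₀ δ j) := by
  induction j with
  | zero => exact (LipschitzWith.const x₀).weaken zero_le
  | succ j ih =>
    refine LipschitzWith.of_dist_le_mul fun a b ↦ ?_
    simp only [delayIterate, dist_eq_norm, add_sub_add_left_eq_sub]
    refine (norm_integral_sub_le (hF.comp ih.continuous) (fun s ↦ hL _) _ _).trans ?_
    gcongr
    refine (abs_max_sub_max_le_abs _ _ _).trans ?_
    simp

/-- The value at `t` uses the previous iterate only up to time `t - δ`, so each iteration freezes
one more interval of length `δ`. -/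
theorem delayIterate_succ_eq {F : E → E} (x₀ : E) {δ : ℝ} (hδ : 0 ≤ δ) (j : ℕ) :
    ∀ t ≤ j * δ, delayIterate F x₀ δ (j + 1) t = delayIterate F x₀ δ j t := by
  induction j with
  | zero =>
    intro t ht
    have : max (t - δ) 0 = 0 := max_eq_right (by simp at ht; linarith)
    simp [delayIterate, this]
  | succ j ih =>
    intro t ht
    rw [delayIterate.eq_2 F x₀ δ j, delayIterate.eq_2 F x₀ δ (j + 1)]
    refine congrArg (x₀ + ·) ?_
    refine intervalIntegral.integral_congr (E := E) fun s hs ↦ ?_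
    rw [uIcc_of_le (le_max_right _ _)] at hs
    rw [ih s]
    refine hs.2.trans (max_le ?_ (by positivity))
    push_cast at ht
    linarith

/-- Once `j * δ ≥ 1` the iterate solves the delayed equation exactly on `[0, 1]`; dropping the delay
changes the integral over a length of at most `δ`. -/
theorem exists_approximate_solution {F : E → E} (hF : Continuous F) {L : ℝ≥0}
    (hL : ∀ z, ‖F z‖ ≤ L) (x₀ : E) {δ : ℝ} (hδ : 0 < δ) :
    ∃ x : ℝ → E, LipschitzWith L x ∧ x 0 = x₀ ∧
      ∀ t ∈ Icc (0 : ℝ) 1, ‖x t - (x₀ + ∫ s in (0 : ℝ)..t, F (x s))‖ ≤ L * δ := by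
  obtain ⟨j, hj⟩ := exists_nat_ge (1 / δ)
  have hlip := delayIterate_lipschitz hF hL x₀ δ j
  refine ⟨delayIterate F x₀ δ j, hlip, ?_, fun t ht ↦ ?_⟩
  · cases j with
    | zero => rfl
    | succ j => simp [delayIterate, hδ.le]
  · have htj : t ≤ j * δ := ht.2.trans ((div_le_iff₀ hδ).1 hj)
    rw [← delayIterate_succ_eq x₀ hδ.le j t htj, delayIterate, add_sub_add_left_eq_sub]
    refine (norm_integral_sub_le (hF.comp hlip.continuous) (fun s ↦ hL _) _ _).trans ?_
    gcongr
    rcases le_total (t - δ) 0 with h | h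
    · rw [max_eq_right h, zero_sub, abs_neg, abs_of_nonneg ht.1]
      linarith
    · rw [max_eq_left h]
      simp [abs_of_pos hδ]

omit [NormedSpace ℝ E] in
theorem isCompact_lipschitz [ProperSpace E] (L : ℝ≥0) (x₀ : E) :
    IsCompact {f : C(Icc (0 : ℝ) 1, E) | LipschitzWith L f ∧ f 0 = x₀} := by
  refine ArzelaAscoli.isCompact_of_equicontinuous _ ?_ ?_
  · have himg : ContinuousMap.toFun '' {f : C(Icc (0 : ℝ) 1, E) | LipschitzWith L f ∧ f 0 = x₀}
        = {f : Icc (0 : ℝ) 1 → E | LipschitzWith L f ∧ f 0 = x₀} := by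
      ext f
      constructor
      · rintro ⟨f, hf, rfl⟩
        exact hf
      · exact fun hf ↦ ⟨⟨f, hf.1.continuous⟩, hf, rfl⟩
    rw [himg]
    have hK : IsCompact (univ.pi fun _ : Icc (0 : ℝ) 1 ↦ Metric.closedBall x₀ (L : ℝ)) :=
      isCompact_univ_pi fun _ ↦ isCompact_closedBall _ _
    refine hK.of_isClosed_subset ?_ ?_
    · have : {f : Icc (0 : ℝ) 1 → E | LipschitzWith L f ∧ f 0 = x₀}
          = (⋂ a, ⋂ b, {f | dist (f a) (f b) ≤ L * dist a b}) ∩ {f | f 0 = x₀} := by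
        ext f
        simp only [lipschitzWith_iff_dist_le_mul, mem_inter_iff, mem_iInter, mem_ofPred_eq]
      rw [this]
      refine IsClosed.inter (isClosed_iInter fun a ↦ isClosed_iInter fun b ↦ ?_) ?_
      · exact isClosed_le (by fun_prop) continuous_const
      · exact isClosed_eq (by fun_prop) continuous_const
    · rintro f ⟨hf, h0⟩ t -
      rw [Metric.mem_closedBall, ← h0]
      refine (hf.dist_le_mul t 0).trans ?_
      have : dist t 0 ≤ 1 := by
        rw [Subtype.dist_eq, Real.dist_eq]
        simpa [abs_of_nonneg t.2.1] using t.2.2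
      nlinarith [L.2]
  · exact (LipschitzWith.uniformEquicontinuous _ L fun f ↦ f.2.1).equicontinuous

/-- **Peano existence theorem** for a bounded continuous autonomous vector field. -/
theorem exists_solution_of_bounded [FiniteDimensional ℝ E] {F : E → E} (hF : Continuous F)
    {L : ℝ≥0} (hL : ∀ z, ‖F z‖ ≤ L) (x₀ : E) :
    ∃ x : ℝ → E, x 0 = x₀ ∧ ∀ t ∈ Icc (0 : ℝ) 1, HasDerivAt x (F (x t)) t := by
  have : ProperSpace E := FiniteDimensional.proper ℝ E
  have : CompleteSpace E := FiniteDimensional.complete ℝ E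
  choose u hu hu0 hue using fun m : ℕ ↦ exists_approximate_solution hF hL x₀
    (δ := 1 / (m + 1)) (by positivity)
  let v : ℕ → C(Icc (0 : ℝ) 1, E) := fun m ↦ ⟨fun t ↦ u m t, (hu m).continuous.comp (by fun_prop)⟩
  have hv : ∀ m, v m ∈ {f : C(Icc (0 : ℝ) 1, E) | LipschitzWith L f ∧ f 0 = x₀} := fun m ↦
    ⟨by simpa using! (hu m).comp (LipschitzWith.subtype_val _), hu0 m⟩
  obtain ⟨f, -, φ, hφ, hlim⟩ := (isCompact_lipschitz L x₀).tendsto_subseq hv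
  have hpt : ∀ t : Icc (0 : ℝ) 1, Tendsto (fun m ↦ u (φ m) t) atTop (𝓝 (f t)) := fun t ↦
    ((continuous_eval_const t).tendsto f).comp hlim
  let y : ℝ → E := fun t ↦ f (projIcc 0 1 zero_le_one t)
  have hyc : Continuous y := f.continuous.comp continuous_projIcc
  have hy : ∀ t ∈ Icc (0 : ℝ) 1, y t = x₀ + ∫ s in (0 : ℝ)..t, F (y s) := by
    intro t ht
    have hpt' : ∀ s ∈ Icc (0 : ℝ) 1, Tendsto (fun m ↦ u (φ m) s) atTop (𝓝 (y s)) := by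
      intro s hs
      simpa [y, projIcc_of_mem _ hs] using hpt ⟨s, hs⟩
    have h1 : Tendsto (fun m ↦ x₀ + ∫ s in (0 : ℝ)..t, F (u (φ m) s)) atTop
        (𝓝 (x₀ + ∫ s in (0 : ℝ)..t, F (y s))) := by
      refine tendsto_const_nhds.add ?_
      refine intervalIntegral.tendsto_integral_filter_of_dominated_convergence (fun _ ↦ (L : ℝ))
        ?_ ?_ (by simp) ?_
      · exact .of_forall fun m ↦
          (hF.comp (hu (φ m)).continuous).aestronglyMeasurable
      · exact .of_forall fun m ↦ .of_forall fun s _ ↦ hL _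
      · refine .of_forall fun s hs ↦ ?_
        rw [uIoc_of_le ht.1] at hs
        exact (hF.tendsto _).comp (hpt' s ⟨hs.1.le, hs.2.trans ht.2⟩)
    have h2 : Tendsto (fun m ↦ u (φ m) t - (x₀ + ∫ s in (0 : ℝ)..t, F (u (φ m) s))) atTop (𝓝 0) := by
      refine squeeze_zero_norm (fun m ↦ hue (φ m) t ht) ?_
      have := (tendsto_one_div_add_atTop_nhds_zero_nat (𝕜 := ℝ)).comp hφ.tendsto_atTop
      simpa using this.const_mul (L : ℝ)
    exact sub_eq_zero.1 (tendsto_nhds_unique ((hpt' t ht).sub h1) h2)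
  -- The integral, not `y`, is returned: `y` is clamped outside `[0, 1]`, whereas the integral has
  -- two-sided derivatives at the endpoints too.
  refine ⟨fun t ↦ x₀ + ∫ s in (0 : ℝ)..t, F (y s), by simp, fun t ht ↦ ?_⟩
  have hFy : Continuous fun s ↦ F (y s) := hF.comp hyc
  have := (intervalIntegral.integral_hasDerivAt_right (hFy.intervalIntegrable 0 t)
    (hFy.stronglyMeasurableAtFilter _ _) hFy.continuousAt).const_add x₀
  simpa only [← hy t ht] using this

/-- **Peano existence theorem**, local version. -/
theorem exists_solution_of_continuousOn [FiniteDimensional ℝ E] {F : E → E} {s : Set E} {x₀ : E}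
    (hs : IsOpen s) (hF : ContinuousOn F s) (hx₀ : x₀ ∈ s) :
    ∃ x : ℝ → E, x 0 = x₀ ∧ ∃ T > 0, ∀ t ∈ Icc (0 : ℝ) T, x t ∈ s ∧ HasDerivAt x (F (x t)) t := by
  obtain ⟨r, hr, hrs⟩ := Metric.isOpen_iff.1 hs x₀ hx₀
  -- The cutoff makes `F` globally continuous and bounded, and equals 1 on the ball of radius `r /
  -- 4`, where the solution stays for a short time.
  let χ : ContDiffBump x₀ := ⟨r / 4, r / 2, by positivity, by linarith⟩
  have hsupp : tsupport χ ⊆ s := by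
    rw [χ.tsupport_eq]
    exact (Metric.closedBall_subset_ball (by simp only [χ]; linarith)).trans hrs
  have hcont : Continuous fun z ↦ χ z • F z := by
    refine ContinuousOn.continuous_of_tsupport_subset (χ.continuous.continuousOn.smul hF) hs ?_
    exact (tsupport_smul_subset_left _ _).trans hsupp
  have hcomp : HasCompactSupport fun z ↦ χ z • F z := χ.hasCompactSupport.smul_right
  obtain ⟨C, hC⟩ := hcomp.exists_bound_of_continuous hcont
  obtain ⟨x, hx0, hx⟩ := exists_solution_of_bounded hcont (L := C.toNNReal)
    (fun z ↦ (hC z).trans (Real.le_coe_toNNReal C)) x₀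
  refine ⟨x, hx0, ?_⟩
  have hev : ∀ᶠ t in 𝓝 (0 : ℝ), x t ∈ Metric.ball x₀ (r / 4) := by
    refine (hx 0 (by simp)).continuousAt.eventually_mem (Metric.isOpen_ball.mem_nhds ?_)
    rw [hx0]
    exact Metric.mem_ball_self (by positivity)
  obtain ⟨ε, hε, hball⟩ := Metric.eventually_nhds_iff_ball.1 hev
  refine ⟨min (ε / 2) 1, by positivity, fun t ht ↦ ?_⟩
  have hxt : x t ∈ Metric.ball x₀ (r / 4) := by
    refine hball t ?_
    rw [Metric.mem_ball, Real.dist_eq, sub_zero, abs_of_nonneg ht.1]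
    linarith [ht.2.trans (min_le_left _ _)]
  refine ⟨hrs (Metric.ball_subset_ball (by linarith) hxt), ?_⟩
  have := hx t ⟨ht.1, ht.2.trans (min_le_right _ _)⟩
  rwa [χ.one_of_mem_closedBall (Metric.ball_subset_closedBall hxt), one_smul] at this

end PeanoODE

namespace AbstractBoundary

variable {n : ℕ}

/-! ### Immersions in equal dimension. -/

section LocalDiffeo

variable {M N : Type*} [TopologicalSpace M] [ChartedSpace (EuclideanSpace ℝ (Fin n)) M]
  [TopologicalSpace N] [ChartedSpace (EuclideanSpace ℝ (Fin n)) N]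

/-- The normal form of an immersion carries a complement `F`; a dimension count forces it to vanish.
-/
theorem exists_continuousLinearEquiv_of_prod {E F : Type*} [NormedAddCommGroup E]
    [NormedSpace ℝ E] [FiniteDimensional ℝ E] [NormedAddCommGroup F] [NormedSpace ℝ F]
    (e : (E × F) ≃L[ℝ] E) : ∃ L : E ≃L[ℝ] E, ∀ u, L u = e (u, 0) := by
  have : FiniteDimensional ℝ (E × F) := e.symm.toLinearEquiv.finiteDimensional
  have : FiniteDimensional ℝ F :=
    Module.Finite.of_surjective (LinearMap.snd ℝ E F) LinearMap.snd_surjective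
  have hrank : Module.finrank ℝ F = 0 := by
    have := e.toLinearEquiv.finrank_eq
    rw [Module.finrank_prod] at this
    omega
  have : Subsingleton F := Module.finrank_zero_iff.1 hrank
  have hz : ∀ p : E × F, (p.1, (0 : F)) = p := fun p ↦ Prod.ext rfl (Subsingleton.elim _ _)
  refine ⟨ContinuousLinearEquiv.equivOfInverse (e.toContinuousLinearMap ∘L .inl ℝ E F)
    (.fst ℝ E F ∘L e.symm.toContinuousLinearMap) (fun u ↦ ?_) (fun u ↦ ?_), fun u ↦ rfl⟩
  · simp
  · simp [hz]

/-- An immersion between manifolds of the same dimension is a local diffeomorphism. -/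
theorem isLocalDiffeomorph_of_isImmersion {f : M → N} (hf : IsImmersion (𝓡 n) (𝓡 n) ∞ f) :
    IsLocalDiffeomorph (𝓡 n) (𝓡 n) ∞ f := by
  intro x
  have h := hf.isImmersionAt x
  obtain ⟨L, hL⟩ := exists_continuousLinearEquiv_of_prod h.equiv
  -- In adapted charts `f` is the linear isomorphism `L`, so `Ψ` is `f` with a smooth inverse.
  let Ψ := h.domChart.trans (L.toHomeomorph.toOpenPartialHomeomorph.trans h.codChart.symm)
  have heq : ∀ u ∈ h.domChart.source, h.codChart (f u) = L (h.domChart u) := by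
    intro u hu
    have := h.writtenInCharts (by simpa using! h.domChart.map_source hu :
      h.domChart u ∈ (h.domChart.extend (𝓡 n)).target)
    simpa [hL, h.domChart.left_inv hu] using this
  have hcod : ∀ u ∈ h.domChart.source, f u ∈ h.codChart.source :=
    fun u hu ↦ h.source_subset_preimage_source hu
  have hsource : ∀ u, u ∈ Ψ.source ↔ u ∈ h.domChart.source := by
    intro u
    constructor
    · intro hu
      simp [Ψ] at hu
      exact hu.1
    · intro hu
      simp [Ψ, hu, ← heq u hu, h.codChart.map_source (hcod u hu)]
  refine ⟨⟨Ψ.toPartialEquiv, Ψ.open_source, Ψ.open_target, ?_, ?_⟩, ?_, ?_⟩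
  · show ContMDiffOn (𝓡 n) (𝓡 n) ∞ (h.codChart.symm ∘ L ∘ h.domChart) Ψ.source
    refine (contMDiffOn_symm_of_mem_maximalAtlas h.codChart_mem_maximalAtlas).comp
      (t := h.codChart.target)
      (L.contDiff.contMDiff.comp_contMDiffOn
        ((contMDiffOn_of_mem_maximalAtlas h.domChart_mem_maximalAtlas).mono fun u hu ↦ (hsource u).1 hu)) ?_
    intro u hu
    have hu := (hsource u).1 hu
    simpa [← heq u hu] using h.codChart.map_source (hcod u hu)
  · show ContMDiffOn (𝓡 n) (𝓡 n) ∞ (h.domChart.symm ∘ L.symm ∘ h.codChart) Ψ.target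
    refine (contMDiffOn_symm_of_mem_maximalAtlas h.domChart_mem_maximalAtlas).comp
      (t := h.domChart.target)
      (L.symm.contDiff.contMDiff.comp_contMDiffOn
        ((contMDiffOn_of_mem_maximalAtlas h.codChart_mem_maximalAtlas).mono fun u hu ↦ ?_)) ?_
    · simp [Ψ] at hu
      exact hu.1
    · intro u hu
      simp [Ψ] at hu
      exact hu.2
  · exact (hsource x).2 h.mem_domChart_source
  · intro u hu
    have hu := (hsource u).1 hu
    show f u = h.codChart.symm (L (h.domChart u))
    rw [← heq u hu, h.codChart.left_inv (hcod u hu)]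

end LocalDiffeo

/-! ### Envelopments as open embeddings, and pulled-back charts. -/

namespace Envelopment

variable {M N : Type*} [TopologicalSpace M] [ChartedSpace (EuclideanSpace ℝ (Fin n)) M]
  [TopologicalSpace N] [ChartedSpace (EuclideanSpace ℝ (Fin n)) N]

theorem isLocalDiffeomorph (ψ : Envelopment n M N) :
    IsLocalDiffeomorph (𝓡 n) (𝓡 n) ∞ ψ.toFun :=
  isLocalDiffeomorph_of_isImmersion ψ.isSmoothEmbedding.isImmersion

theorem isOpenEmbedding (ψ : Envelopment n M N) : IsOpenEmbedding ψ.toFun :=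
  .of_isEmbedding_isOpenMap ψ.isSmoothEmbedding.isEmbedding ψ.isLocalDiffeomorph.isOpenMap

variable [Nonempty M]

/-- The envelopment as a homeomorphism onto its open image. -/
noncomputable def toOpenPartialHomeomorph (ψ : Envelopment n M N) : OpenPartialHomeomorph M N :=
  ψ.isOpenEmbedding.toOpenPartialHomeomorph ψ.toFun

/-- By injectivity the global inverse agrees near each image point with the smooth local inverse. -/
theorem contMDiffOn_symm (ψ : Envelopment n M N) :
    ContMDiffOn (𝓡 n) (𝓡 n) ∞ ψ.toOpenPartialHomeomorph.symm (range ψ.toFun) := by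
  rintro _ ⟨x, rfl⟩
  have h := ψ.isLocalDiffeomorph x
  refine (h.localInverse_contMDiffAt.congr_of_eventuallyEq ?_).contMDiffWithinAt
  filter_upwards [h.localInverse_eventuallyEq_right] with z hz
  apply ψ.isOpenEmbedding.injective
  have hz : ψ.toFun (h.localInverse z) = z := hz
  rw [hz]
  exact ψ.toOpenPartialHomeomorph.right_inv
    (by simpa [toOpenPartialHomeomorph] using ⟨_, hz⟩)

/-- The pullback of a chart under an envelopment. -/
noncomputable def pullbackChart (ψ : Envelopment n M N)
    (e : OpenPartialHomeomorph N (EuclideanSpace ℝ (Fin n))) :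
    OpenPartialHomeomorph M (EuclideanSpace ℝ (Fin n)) :=
  ψ.toOpenPartialHomeomorph.trans e

variable (ψ : Envelopment n M N) (e : OpenPartialHomeomorph N (EuclideanSpace ℝ (Fin n)))

theorem mem_pullbackChart_source {x : M} :
    x ∈ (ψ.pullbackChart e).source ↔ ψ.toFun x ∈ e.source := by
  simp [pullbackChart, toOpenPartialHomeomorph]

theorem mem_pullbackChart_target {y : EuclideanSpace ℝ (Fin n)} :
    y ∈ (ψ.pullbackChart e).target ↔ y ∈ e.target ∧ e.symm y ∈ range ψ.toFun := by
  simp [pullbackChart, toOpenPartialHomeomorph]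

variable {ψ e} in
theorem apply_pullbackChart_symm {y : EuclideanSpace ℝ (Fin n)}
    (hy : y ∈ (ψ.pullbackChart e).target) :
    ψ.toFun ((ψ.pullbackChart e).symm y) = e.symm y :=
  ψ.toOpenPartialHomeomorph.right_inv
    (by simpa [toOpenPartialHomeomorph] using ((ψ.mem_pullbackChart_target e).1 hy).2)

theorem pullbackChart_mem_maximalAtlas [IsManifold (𝓡 n) ∞ M]
    (he : e ∈ IsManifold.maximalAtlas (𝓡 n) ∞ N) :
    ψ.pullbackChart e ∈ IsManifold.maximalAtlas (𝓡 n) ∞ M := by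
  refine OpenPartialHomeomorph.mem_maximalAtlas_of_contMDiffOn _ ?_ ?_
  · exact (contMDiffOn_of_mem_maximalAtlas he).comp ψ.isLocalDiffeomorph.contMDiff.contMDiffOn
      fun x hx ↦ (ψ.mem_pullbackChart_source e).1 hx
  · exact ψ.contMDiffOn_symm.comp ((contMDiffOn_symm_of_mem_maximalAtlas he).mono
      fun y hy ↦ ((ψ.mem_pullbackChart_target e).1 hy).1)
      fun y hy ↦ ((ψ.mem_pullbackChart_target e).1 hy).2

end Envelopment

/-! ### Metric components in a chart. -/

section InChart

variable {k : ℕ∞} {M N : Type*} [TopologicalSpace M] [ChartedSpace (EuclideanSpace ℝ (Fin n)) M]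
  [IsManifold (𝓡 n) ∞ M] [TopologicalSpace N] [ChartedSpace (EuclideanSpace ℝ (Fin n)) N]
  [IsManifold (𝓡 n) ∞ N]

/-- The chain rule for `ψ.toFun ∘ (ψ.pullbackChart e).symm = e.symm`, combined with `ψ^* h = g`. -/
theorem Envelopment.IsExtension.inChart_eq [Nonempty M] {ψ : Envelopment n M N}
    {g : PseudoRiemannianMetric n k M} {h : PseudoRiemannianMetric n k N}
    (hext : ψ.IsExtension g h) {e : OpenPartialHomeomorph N (EuclideanSpace ℝ (Fin n))}
    (he : e ∈ IsManifold.maximalAtlas (𝓡 n) ∞ N) {y : EuclideanSpace ℝ (Fin n)}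
    (hy : y ∈ (ψ.pullbackChart e).target) :
    g.inChart (ψ.pullbackChart e) y = h.inChart e y := by
  have h1 : MDifferentiableAt (𝓡 n) (𝓡 n) (ψ.pullbackChart e).symm y :=
    (contMDiffAt_symm_of_mem_maximalAtlas (ψ.pullbackChart_mem_maximalAtlas e he)
      hy).mdifferentiableAt (by simp)
  have h2 : MDifferentiableAt (𝓡 n) (𝓡 n) ψ.toFun ((ψ.pullbackChart e).symm y) :=
    (ψ.isLocalDiffeomorph.contMDiff _).mdifferentiableAt (by simp)
  have heq : ψ.toFun ∘ (ψ.pullbackChart e).symm =ᶠ[𝓝 y] e.symm := by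
    filter_upwards [(ψ.pullbackChart e).open_target.mem_nhds hy] with z hz
    exact Envelopment.apply_pullbackChart_symm hz
  have hcomp := mfderiv_comp y h2 h1
  rw [heq.mfderiv_eq] at hcomp
  ext a b
  have key := hext ((ψ.pullbackChart e).symm y)
    (mfderiv (𝓡 n) (𝓡 n) (ψ.pullbackChart e).symm y a)
    (mfderiv (𝓡 n) (𝓡 n) (ψ.pullbackChart e).symm y b)
  have hpt := Envelopment.apply_pullbackChart_symm hy
  let H : N → EuclideanSpace ℝ (Fin n) →L[ℝ] EuclideanSpace ℝ (Fin n) →L[ℝ] ℝ := h.inner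
  let A : EuclideanSpace ℝ (Fin n) →L[ℝ] EuclideanSpace ℝ (Fin n) :=
    mfderiv (𝓡 n) (𝓡 n) e.symm y
  have e1 : ∀ v, A v = mfderiv (𝓡 n) (𝓡 n) ψ.toFun ((ψ.pullbackChart e).symm y)
    (mfderiv (𝓡 n) (𝓡 n) (ψ.pullbackChart e).symm y v) := fun v ↦ congrArg (· v) hcomp
  show _ = H (e.symm y) (A a) (A b)
  rw [← hpt, e1, e1]
  exact key.symm

/-- For fixed `a`, `b` the component is the metric evaluated on two coordinate fields, which are
smooth because they come from the tangent map of `e.symm`. -/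
theorem PseudoRiemannianMetric.contDiffOn_inChart (hk : 1 ≤ k) (h : PseudoRiemannianMetric n k N)
    {e : OpenPartialHomeomorph N (EuclideanSpace ℝ (Fin n))}
    (he : e ∈ IsManifold.maximalAtlas (𝓡 n) ∞ N) : ContDiffOn ℝ 1 (h.inChart e) e.target := by
  have hsymm := contMDiffOn_symm_of_mem_maximalAtlas he
  have htan := hsymm.contMDiffOn_tangentMapWithin (m := 1) (by norm_num; exact WithTop.coe_le_coe.2 le_top) e.open_target.uniqueMDiffOn
  have hsec : ∀ a : EuclideanSpace ℝ (Fin n), ContMDiffOn (𝓡 n) (𝓡 n).tangent 1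
      (fun y ↦ (TotalSpace.mk' (EuclideanSpace ℝ (Fin n)) (e.symm y)
        (mfderiv (𝓡 n) (𝓡 n) e.symm y a) : TangentBundle (𝓡 n) N)) e.target := by
    intro a
    have hc : ContMDiff (𝓡 n) (𝓡 n).tangent 1 (fun y : EuclideanSpace ℝ (Fin n) ↦
        (TotalSpace.mk' (EuclideanSpace ℝ (Fin n)) y a :
          TangentBundle (𝓡 n) (EuclideanSpace ℝ (Fin n)))) := by
      intro y
      refine (contMDiffAt_section (E := TangentSpace (𝓡 n)) (s := fun _ ↦ a) y).2 ?_
      simpa using! contMDiffAt_const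
    refine (htan.comp hc.contMDiffOn (fun y hy ↦ hy)).congr fun y hy ↦ ?_
    simp only [Function.comp, tangentMapWithin]
    rw [mfderivWithin_of_isOpen e.open_target hy]
  have hh : ContMDiffOn (𝓡 n) ((𝓡 n).prod 𝓘(ℝ, EuclideanSpace ℝ (Fin n) →L[ℝ]
      EuclideanSpace ℝ (Fin n) →L[ℝ] ℝ)) 1 (fun y ↦ TotalSpace.mk'
        (EuclideanSpace ℝ (Fin n) →L[ℝ] EuclideanSpace ℝ (Fin n) →L[ℝ] ℝ)
      (E := fun x : N ↦ TangentSpace (𝓡 n) x →L[ℝ] TangentSpace (𝓡 n) x →L[ℝ] ℝ)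
      (e.symm y) (h.inner (e.symm y))) e.target :=
    (h.contMDiff.of_le (by exact_mod_cast hk)).comp_contMDiffOn (hsymm.of_le (by norm_num))
  rw [contDiffOn_clm_apply]
  intro a
  rw [contDiffOn_clm_apply]
  intro b
  have := ContMDiffOn.clm_bundle_apply₂ (F₁ := EuclideanSpace ℝ (Fin n))
    (F₂ := EuclideanSpace ℝ (Fin n)) (F₃ := ℝ) (E₁ := fun x : N ↦ TangentSpace (𝓡 n) x)
    (E₂ := fun x : N ↦ TangentSpace (𝓡 n) x) (E₃ := fun _ : N ↦ ℝ) hh (hsec a) (hsec b)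
  intro y hy
  have := ((contMDiffWithinAt_totalSpace).1 (this y hy)).2
  rw [← contMDiffWithinAt_iff_contDiffWithinAt]
  simpa using! this

theorem PseudoRiemannianMetric.inChart_injective (h : PseudoRiemannianMetric n k N)
    {e : OpenPartialHomeomorph N (EuclideanSpace ℝ (Fin n))}
    (he : e ∈ IsManifold.maximalAtlas (𝓡 n) ∞ N) {y : EuclideanSpace ℝ (Fin n)}
    (hy : y ∈ e.target) : Function.Injective (h.inChart e y) := by
  have h1 : MDifferentiableAt (𝓡 n) (𝓡 n) e.symm y :=
    (contMDiffAt_symm_of_mem_maximalAtlas he hy).mdifferentiableAt (by simp)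
  have h2 : MDifferentiableAt (𝓡 n) (𝓡 n) e (e.symm y) :=
    (contMDiffAt_of_mem_maximalAtlas he (e.map_target hy)).mdifferentiableAt (by simp)
  let A : EuclideanSpace ℝ (Fin n) →L[ℝ] EuclideanSpace ℝ (Fin n) :=
    mfderiv (𝓡 n) (𝓡 n) e.symm y
  let B : EuclideanSpace ℝ (Fin n) →L[ℝ] EuclideanSpace ℝ (Fin n) :=
    mfderiv (𝓡 n) (𝓡 n) e (e.symm y)
  have hBA : ∀ v, B (A v) = v := by
    have hcomp := mfderiv_comp y h2 h1
    have heq : e ∘ e.symm =ᶠ[𝓝 y] id := by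
      filter_upwards [e.open_target.mem_nhds hy] with z hz using e.right_inv hz
    rw [heq.mfderiv_eq, mfderiv_id] at hcomp
    exact fun v ↦ (congrArg (· v) hcomp).symm
  have hA : Function.Injective A := Function.LeftInverse.injective hBA
  have hAs : Function.Surjective A := LinearMap.surjective_of_injective (f := A.toLinearMap) hA
  refine (injective_iff_map_eq_zero _).2 fun a ha ↦ ?_
  refine hA (Eq.trans (h.nondegenerate (e.symm y) (A a) fun w ↦ ?_) (map_zero A).symm)
  obtain ⟨b, rfl⟩ := hAs w
  exact congrArg (· b) ha

end InChart

end AbstractBoundary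

namespace AbstractBoundary

variable {n : ℕ}

/-! ### Geodesics of a `C^1` metric in coordinates. -/

section Coordinates

variable {E : Type*} [NormedAddCommGroup E] [NormedSpace ℝ E] [FiniteDimensional ℝ E]

theorem isInvertible_of_injective {B : E →L[ℝ] E →L[ℝ] ℝ} (hB : Function.Injective B) :
    ∃ L : E ≃L[ℝ] (E →L[ℝ] ℝ), (L : E →L[ℝ] E →L[ℝ] ℝ) = B := by
  have hrank : Module.finrank ℝ E = Module.finrank ℝ (E →L[ℝ] ℝ) := by
    have e : (E →ₗ[ℝ] ℝ) ≃ₗ[ℝ] (E →L[ℝ] ℝ) := LinearMap.toContinuousLinearMap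
    rw [← e.finrank_eq]
    exact (Subspace.dual_finrank_eq (K := ℝ) (V := E)).symm
  refine ⟨(LinearEquiv.ofInjectiveOfFinrankEq B.toLinearMap hB hrank).toContinuousLinearEquiv, ?_⟩
  rfl

set_option maxSynthPendingDepth 3 in
/-- Existence of geodesics of a `C^1` metric in coordinates. -/
theorem exists_coordinate_geodesic {G : E → E →L[ℝ] E →L[ℝ] ℝ} {s : Set E} (hs : IsOpen s)
    (hG : ContDiffOn ℝ 1 G s) (hinj : ∀ y ∈ s, Function.Injective (G y)) {y₀ v₀ : E}
    (hy₀ : y₀ ∈ s) (hv₀ : v₀ ≠ 0) :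
    ∃ X V A : ℝ → E, X 0 = y₀ ∧ V 0 = v₀ ∧ ∃ T > 0, ∀ t ∈ Icc (0 : ℝ) T,
      X t ∈ s ∧ V t ≠ 0 ∧ HasDerivAt X (V t) t ∧ HasDerivAt V (A t) t ∧
      ∀ w, G (X t) (A t) w + (fderiv ℝ G (X t) (V t) (V t) w
          + fderiv ℝ G (X t) (V t) (V t) w - fderiv ℝ G (X t) w (V t) (V t)) / 2 = 0 := by
  -- With both velocity slots equal, the first two Christoffel terms coincide; the double flip moves
  -- the free vector into the differentiation slot.
  let Γ : E × E → E →L[ℝ] ℝ := fun z ↦ fderiv ℝ G z.1 z.2 z.2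
    - (1 / 2 : ℝ) • (((fderiv ℝ G z.1).flip z.2).flip z.2)
  let acc : E × E → E := fun z ↦ -(G z.1).inverse (Γ z)
  have hΓ : ∀ y v w, Γ (y, v) w =
      (fderiv ℝ G y v v w + fderiv ℝ G y v v w - fderiv ℝ G y w v v) / 2 := by
    intro y v w
    simp only [Γ, sub_apply, smul_apply, smul_eq_mul,
      ContinuousLinearMap.flip_apply]
    ring
  have hacc : ∀ z : E × E, z.1 ∈ s → G z.1 (acc z) = -Γ z := by
    intro z hz
    obtain ⟨L, hL⟩ := isInvertible_of_injective (hinj z.1 hz)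
    simp [acc, ← hL]
  have hdG : ContinuousOn (fderiv ℝ G) s := hG.continuousOn_fderiv_of_isOpen hs le_rfl
  have hmaps : MapsTo Prod.fst (s ×ˢ ({0}ᶜ : Set E)) s := fun z hz ↦ hz.1
  have hDc : ContinuousOn (fun z : E × E ↦ fderiv ℝ G z.1) (s ×ˢ ({0}ᶜ : Set E)) :=
    hdG.comp continuousOn_fst hmaps
  have hflip₁ : Continuous fun D : E →L[ℝ] E →L[ℝ] E →L[ℝ] ℝ ↦ D.flip :=
    (ContinuousLinearMap.flipₗᵢ ℝ E E (E →L[ℝ] ℝ)).continuous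
  have hflip₂ : Continuous fun D : E →L[ℝ] E →L[ℝ] ℝ ↦ D.flip :=
    (ContinuousLinearMap.flipₗᵢ ℝ E E ℝ).continuous
  have hΓc : ContinuousOn Γ (s ×ˢ ({0}ᶜ : Set E)) := by
    refine ContinuousOn.sub ((hDc.clm_apply continuousOn_snd).clm_apply continuousOn_snd)
      (ContinuousOn.fun_const_smul ?_ _)
    exact (hflip₂.comp_continuousOn
      ((hflip₁.comp_continuousOn hDc).clm_apply continuousOn_snd)).clm_apply continuousOn_snd
  have hinv : ContinuousOn (fun z : E × E ↦ (G z.1).inverse) (s ×ˢ ({0}ᶜ : Set E)) := by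
    refine ContinuousOn.comp (t := s) (g := fun y ↦ (G y).inverse) (fun y hy ↦ ?_)
      continuousOn_fst hmaps
    obtain ⟨L, hL⟩ := isInvertible_of_injective (hinj y hy)
    refine ContinuousAt.comp_continuousWithinAt (g := ContinuousLinearMap.inverse) ?_
      (hG.continuousOn y hy)
    rw [← hL]
    exact (contDiffAt_map_inverse (n := 0) L).continuousAt
  have hH : ContinuousOn (fun z : E × E ↦ (z.2, acc z)) (s ×ˢ ({0}ᶜ : Set E)) :=
    continuousOn_snd.prodMk (hinv.clm_apply hΓc).neg
  -- Solving the first-order system in `s ×ˢ {0}ᶜ` also keeps the velocity nonzero.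
  obtain ⟨x, hx0, T, hT, hx⟩ := PeanoODE.exists_solution_of_continuousOn
    (hs.prod isOpen_compl_singleton) hH (x₀ := (y₀, v₀)) ⟨hy₀, hv₀⟩
  refine ⟨fun t ↦ (x t).1, fun t ↦ (x t).2, fun t ↦ acc (x t), by simp [hx0], by simp [hx0],
    T, hT, fun t ht ↦ ?_⟩
  obtain ⟨hmem, hder⟩ := hx t ht
  refine ⟨hmem.1, hmem.2, hder.fst, hder.snd, fun w ↦ ?_⟩
  rw [hacc _ hmem.1, ← hΓ]
  simp

/-- Near a frontier point of an open set there is a point of the complement at which a ball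
contained in the set touches the complement. -/
theorem exists_interior_ball {W S : Set E} (hW : IsOpen W) (hS : IsOpen S) {c : E} (hcS : c ∈ S)
    (hc : c ∈ closure W) (hcW : c ∉ W) :
    ∃ q b : E, b ∈ S ∧ b ∉ W ∧ 0 < dist b q ∧ Metric.ball q (dist b q) ⊆ W := by
  obtain ⟨r, hr, hrS⟩ := Metric.isOpen_iff.1 hS c hcS
  -- With `r / 2`, the nearest point satisfies `dist b c ≤ dist b q + dist q c < r`, so it stays in
  -- `S`.
  obtain ⟨q, hqW, hq⟩ := Metric.mem_closure_iff.1 hc (r / 2) (by positivity)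
  obtain ⟨b, hb, hbd⟩ := hW.isClosed_compl.exists_infDist_eq_dist ⟨c, hcW⟩ q
  have hle : dist q b ≤ dist q c := hbd ▸ Metric.infDist_le_dist_of_mem hcW
  refine ⟨q, b, hrS ?_, hb, dist_pos.2 fun h ↦ hb (h ▸ hqW), ?_⟩
  · rw [Metric.mem_ball]
    linarith [dist_triangle b q c, dist_comm q b, dist_comm q c]
  · rw [dist_comm, ← hbd]
    exact Metric.ball_infDist_compl_subset

omit [FiniteDimensional ℝ E] in
/-- A curve starting on a sphere with velocity pointing to the centre enters the ball. -/
theorem eventually_mem_ball_of_hasDerivAt {X : ℝ → E} {q : E} (hq : 0 < dist (X 0) q)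
    (hX : HasDerivAt X (q - X 0) 0) :
    ∀ᶠ t in 𝓝[>] (0 : ℝ), X t ∈ Metric.ball q (dist (X 0) q) := by
  have ho := ((hasDerivAt_iff_isLittleO.1 hX).def (half_pos hq)).filter_mono
    (nhdsWithin_le_nhds (s := Ioi 0))
  filter_upwards [ho, Ioo_mem_nhdsGT (zero_lt_one (α := ℝ))] with t ht ht01
  rw [Metric.mem_ball, dist_eq_norm]
  rw [sub_zero, Real.norm_eq_abs, abs_of_pos ht01.1] at ht
  -- With `R = dist (X 0) q`, the first term is at most `R * t / 2` and the second has norm `(1 - t)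
  -- * R`: the sum is below `R`.
  have hdecomp : X t - q = (X t - X 0 - t • (q - X 0)) + (1 - t) • (X 0 - q) := by
    module
  rw [hdecomp]
  refine (norm_add_le _ _).trans_lt ?_
  rw [norm_smul, Real.norm_eq_abs, abs_of_pos (sub_pos.2 ht01.2), ← dist_eq_norm (X 0) q]
  nlinarith [mul_pos hq ht01.1]

/-- For a `C^1` metric, near a frontier point of an open set there is a geodesic arc whose initial
point lies outside and whose other points lie inside the set. -/
theorem exists_geodesic_into {G : E → E →L[ℝ] E →L[ℝ] ℝ} {W S : Set E} (hW : IsOpen W)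
    (hS : IsOpen S) (hG : ContDiffOn ℝ 1 G S) (hinj : ∀ y ∈ S, Function.Injective (G y)) {c : E}
    (hcS : c ∈ S) (hc : c ∈ closure W) (hcW : c ∉ W) :
    ∃ X V A : ℝ → E, X 0 ∈ S ∧ X 0 ∉ W ∧ ∃ T > 0, (∀ t ∈ Ioc (0 : ℝ) T, X t ∈ W) ∧
      ∀ t ∈ Icc (0 : ℝ) T, V t ≠ 0 ∧ HasDerivAt X (V t) t ∧ HasDerivAt V (A t) t ∧
        ∀ w, G (X t) (A t) w + (fderiv ℝ G (X t) (V t) (V t) w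
          + fderiv ℝ G (X t) (V t) (V t) w - fderiv ℝ G (X t) w (V t) (V t)) / 2 = 0 := by
  obtain ⟨q, b, hbS, hbW, hpos, hball⟩ := exists_interior_ball hW hS hcS hc hcW
  obtain ⟨X, V, A, rfl, hV0, T, hT, hX⟩ := exists_coordinate_geodesic hS hG hinj hbS
    (v₀ := q - b) (sub_ne_zero.2 (dist_pos.1 hpos).symm)
  have hev := eventually_mem_ball_of_hasDerivAt hpos (hV0 ▸ (hX 0 ⟨le_rfl, hT.le⟩).2.2.1)
  obtain ⟨ε, hε, hεX⟩ := mem_nhdsGT_iff_exists_Ioc_subset.1 hev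
  refine ⟨X, V, A, hbS, hbW, min ε T, lt_min hε hT, fun t ht ↦ ?_, fun t ht ↦ ?_⟩
  · exact hball (hεX ⟨ht.1, ht.2.trans (min_le_left _ _)⟩)
  · exact (hX t ⟨ht.1, ht.2.trans (min_le_right _ _)⟩).2

end Coordinates

/-! ### The reversed geodesic and the contradiction. -/

section Main

theorem paramInterval_coe (a b : ℝ) : paramInterval a (b : EReal) = Ico a b := by
  ext t
  simp [paramInterval]

set_option maxSynthPendingDepth 3 in
theorem christoffelFirst_congr {G₁ G₂ : EuclideanSpace ℝ (Fin n) →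
      (EuclideanSpace ℝ (Fin n) →L[ℝ] EuclideanSpace ℝ (Fin n) →L[ℝ] ℝ)}
    {y : EuclideanSpace ℝ (Fin n)} (hG : G₁ =ᶠ[𝓝 y] G₂) (u v w : EuclideanSpace ℝ (Fin n)) :
    christoffelFirst G₁ y u v w = christoffelFirst G₂ y u v w := by
  have : fderiv ℝ G₁ y = fderiv ℝ G₂ y := hG.fderiv_eq
  simp only [christoffelFirst, this]

set_option maxSynthPendingDepth 3 in
-- Quadratic dependence on velocity lets a geodesic be traversed backwards.
theorem christoffelFirst_neg_neg (G : EuclideanSpace ℝ (Fin n) →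
      (EuclideanSpace ℝ (Fin n) →L[ℝ] EuclideanSpace ℝ (Fin n) →L[ℝ] ℝ))
    (y u v w : EuclideanSpace ℝ (Fin n)) :
    christoffelFirst G y (-u) (-v) w = christoffelFirst G y u v w := by
  simp only [christoffelFirst, map_neg, neg_apply, neg_neg]

variable {M : Type*} [TopologicalSpace M] [ChartedSpace (EuclideanSpace ℝ (Fin n)) M]
  [IsManifold (𝓡 n) ∞ M]

/-- The parametrised curve with a given coordinate expression in a chart. -/
noncomputable def ParametrisedCurve.ofChart
    {e : OpenPartialHomeomorph M (EuclideanSpace ℝ (Fin n))}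
    (he : e ∈ IsManifold.maximalAtlas (𝓡 n) ∞ M) {a b : ℝ} (hab : a < b)
    {Y Y' : ℝ → EuclideanSpace ℝ (Fin n)} (hY : ∀ t ∈ Ico a b, HasDerivAt Y (Y' t) t)
    (hY' : ContinuousOn Y' (Ico a b)) (hne : ∀ t ∈ Ico a b, Y' t ≠ 0)
    (hmem : ∀ t ∈ Ico a b, Y t ∈ e.target) : ParametrisedCurve n M :=
  have hcont : ContMDiffOn 𝓘(ℝ, ℝ) (𝓡 n) 1 (fun t ↦ e.symm (Y t)) (Ico a b) := by
    refine ((contMDiffOn_symm_of_mem_maximalAtlas he).of_le (by norm_num)).comp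
      (contMDiffOn_iff_contDiffOn.2 ?_) hmem
    refine (contDiffOn_one_iff_derivWithin (uniqueDiffOn_Ico a b)).2
      ⟨fun t ht ↦ (hY t ht).differentiableAt.differentiableWithinAt, hY'.congr fun t ht ↦ ?_⟩
    exact (hY t ht).hasDerivWithinAt.derivWithin (uniqueDiffOn_Ico a b t ht)
  { left := a
    right := b
    left_lt_right := EReal.coe_lt_coe_iff.2 hab
    toFun := fun t ↦ e.symm (Y t)
    contMDiffOn := by rwa [paramInterval_coe]
    tangent_ne_zero := by
      rw [paramInterval_coe]
      intro t ht h0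
      have h1 := ((hcont t ht).mdifferentiableWithinAt one_ne_zero).hasMFDerivWithinAt
      have h2 : HasMFDerivAt (𝓡 n) (𝓡 n) e (e.symm (Y t)) _ :=
        ((contMDiffAt_of_mem_maximalAtlas he (e.map_target (hmem t ht))).mdifferentiableAt
          (by simp)).hasMFDerivAt
      -- Composing with `e` recovers `Y`, so a zero tangent vector would force `Y' t = 0`.
      have h3 := (h2.comp_hasMFDerivWithinAt t h1).congr_of_eventuallyEq
        (f₁ := Y) (eventually_mem_nhdsWithin.mono fun s hs ↦ (e.right_inv (hmem s hs)).symm)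
        (e.right_inv (hmem t ht)).symm
      let A : ℝ →L[ℝ] EuclideanSpace ℝ (Fin n) :=
        mfderivWithin 𝓘(ℝ, ℝ) (𝓡 n) (fun t ↦ e.symm (Y t)) (Ico a b) t
      let B : EuclideanSpace ℝ (Fin n) →L[ℝ] EuclideanSpace ℝ (Fin n) :=
        mfderiv (𝓡 n) (𝓡 n) e (e.symm (Y t))
      have h4 : HasFDerivWithinAt Y (B ∘L A) (Ico a b) t := h3.hasFDerivWithinAt
      have h5 := (uniqueDiffOn_Ico a b t ht).eq_deriv _ (hY t ht).hasDerivWithinAt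
        h4.hasDerivWithinAt
      refine hne t ht (h5.trans ?_)
      · exact (congrArg (mfderiv (𝓡 n) (𝓡 n) e (e.symm (Y t))) h0).trans (map_zero _) }

/-- A geodesically complete manifold has no envelopment with a boundary point in a manifold to
which the metric extends. -/
theorem Envelopment.IsExtension.closure_subset_range {k : ℕ∞} (hk : 1 ≤ k) [Nonempty M] {N : Type*}
    [TopologicalSpace N] [T2Space N] [ChartedSpace (EuclideanSpace ℝ (Fin n)) N]
    [IsManifold (𝓡 n) ∞ N] {g : PseudoRiemannianMetric n k M}
    (hg : IsCompleteFor (affineGeodesics g)) {ψ : Envelopment n M N}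
    {h : PseudoRiemannianMetric n k N} (hext : ψ.IsExtension g h) :
    closure (range ψ.toFun) ⊆ range ψ.toFun := by
  intro p hp
  by_contra hpr
  let e := chartAt (EuclideanSpace ℝ (Fin n)) p
  have he : e ∈ IsManifold.maximalAtlas (𝓡 n) ∞ N := IsManifold.chart_mem_maximalAtlas p
  have hpe : p ∈ e.source := mem_chart_source _ p
  let e' := ψ.pullbackChart e
  have he' : e' ∈ IsManifold.maximalAtlas (𝓡 n) ∞ M := ψ.pullbackChart_mem_maximalAtlas e he
  have hc : e p ∈ closure e'.target := by
    have hp' : p ∈ closure (e.source ∩ range ψ.toFun) :=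
      e.open_source.inter_closure ⟨hpe, hp⟩
    refine ((e.continuousAt hpe).continuousWithinAt).mem_closure hp' fun z hz ↦ ?_
    refine (ψ.mem_pullbackChart_target e).2 ⟨e.map_source hz.1, ?_⟩
    rw [e.left_inv hz.1]
    exact hz.2
  have hcW : e p ∉ e'.target := fun hmem ↦ hpr <| by
    simpa [e.left_inv hpe] using ((ψ.mem_pullbackChart_target e).1 hmem).2
  obtain ⟨X, V, A, hX0, hX0', T, hT, hXW, hX⟩ := exists_geodesic_into e'.open_target e.open_target
    (h.contDiffOn_inChart hk he) (fun y hy ↦ h.inChart_injective he hy) (e.map_source hpe) hc hcW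
  -- Time is reversed so that the point `X 0`, which is outside `e'.target`, sits at the excluded
  -- end `T` of `[0, T)`.
  have hflip : ∀ t ∈ Ico 0 T, T - t ∈ Ioc 0 T := fun t ht ↦ ⟨sub_pos.2 ht.2, by linarith [ht.1]⟩
  have hflip' : ∀ t ∈ Ico 0 T, T - t ∈ Icc 0 T := fun t ht ↦ Ioc_subset_Icc_self (hflip t ht)
  have hY : ∀ t ∈ Ico 0 T, HasDerivAt (fun t ↦ X (T - t)) (-V (T - t)) t := fun t ht ↦
    (hX _ (hflip' t ht)).2.1.comp_const_sub T t
  have hY' : ∀ t ∈ Ico 0 T, HasDerivAt (fun t ↦ -V (T - t)) (A (T - t)) t := fun t ht ↦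
    ((hX _ (hflip' t ht)).2.2.1.comp_const_sub T t).fun_neg.congr_deriv (neg_neg _)
  let γ : ParametrisedCurve n M := .ofChart he' hT hY
    (fun t ht ↦ (hY' t ht).continuousAt.continuousWithinAt)
    (fun t ht ↦ neg_ne_zero.2 (hX _ (hflip' t ht)).1) (fun t ht ↦ hXW _ (hflip t ht))
  have hdom : γ.domain = Ico 0 T := paramInterval_coe 0 T
  have hγ : ∀ t ∈ Ico 0 T, e' (γ.toFun t) = X (T - t) := fun t ht ↦
    e'.right_inv (hXW _ (hflip t ht))
  have hgeo : γ ∈ affineGeodesics g := by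
    intro t₀ ht₀
    rw [hdom] at ht₀ ⊢
    refine ⟨e', he', e'.map_target (hXW _ (hflip t₀ ht₀)), fun t ↦ -V (T - t),
      fun t ↦ A (T - t), eventually_mem_nhdsWithin.mono fun t ht ↦ ⟨?_, ?_, fun w ↦ ?_⟩⟩
    · exact (hY t ht).hasDerivWithinAt.congr hγ (hγ t ht)
    · exact (hY' t ht).hasDerivWithinAt
    · have hmem := hXW _ (hflip t ht)
      -- Agreement on a neighbourhood is needed, since the Christoffel symbols involve derivatives
      -- of the components.
      have heq : g.inChart e' =ᶠ[𝓝 (X (T - t))] h.inChart e := by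
        filter_upwards [e'.open_target.mem_nhds hmem] with y hy using hext.inChart_eq he hy
      have hgeq := (hX _ (hflip' t ht)).2.2.2 w
      rw [hγ t ht, christoffelFirst_congr heq, heq.eq_of_nhds, christoffelFirst_neg_neg]
      exact hgeq
  obtain ⟨m, hm⟩ := hg γ hgeo (EReal.coe_lt_top T)
  -- In `N` the curve tends both to `ψ.toFun m` and to `e.symm (X 0)`, and only the former is in the
  -- image.
  have hne : ψ.toFun m ≠ e.symm (X 0) := fun heq ↦
    hX0' ((ψ.mem_pullbackChart_target e).2 ⟨hX0, m, heq⟩)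
  obtain ⟨U₁, U₂, hU₁, hU₂, hm₁, hm₂, hdisj⟩ := t2_separation hne
  obtain ⟨s, hs, hsU⟩ := hm _ (ψ.isOpenEmbedding.continuous.continuousAt.preimage_mem_nhds
    (hU₁.mem_nhds hm₁))
  rw [hdom] at hs hsU
  have hlim : Tendsto (fun t ↦ e.symm (X (T - t))) (𝓝[<] T) (𝓝 (e.symm (X 0))) := by
    refine (e.continuousAt_symm hX0).tendsto.comp ?_
    refine (hX 0 ⟨le_rfl, hT.le⟩).2.1.continuousAt.tendsto.comp ?_
    have : Tendsto (fun t ↦ T - t) (𝓝 T) (𝓝 (T - T)) := (continuous_const.sub continuous_id).tendsto T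
    rw [sub_self] at this
    exact this.mono_left nhdsWithin_le_nhds
  obtain ⟨t, htU, hts⟩ := ((hlim.eventually_mem (hU₂.mem_nhds hm₂)).and
    (Ico_mem_nhdsLT hs.2)).exists
  have ht : t ∈ Ico 0 T := ⟨hs.1.trans hts.1, hts.2⟩
  refine hdisj.ne_of_mem (hsU t ht hts.1) htU ?_
  exact Envelopment.apply_pullbackChart_symm (hXW _ (hflip t ht))

end Main

end AbstractBoundary

open AbstractBoundary
theorem theorem6p3 (n : ℕ) (k : ℕ∞) (hk : 1 ≤ k)
    {M : Type*} [TopologicalSpace M] [ChartedSpace (EuclideanSpace ℝ (Fin n)) M]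
    [IsManifold (𝓡 n) ∞ M] [T2Space M] [ParacompactSpace M] [ConnectedSpace M]
    (g : PseudoRiemannianMetric n k M) (hg : IsCompleteFor (affineGeodesics g))
    {N : Type*} [TopologicalSpace N] [ChartedSpace (EuclideanSpace ℝ (Fin n)) N]
    [IsManifold (𝓡 n) ∞ N] [T2Space N] [ParacompactSpace N] [ConnectedSpace N]
    (φ : Envelopment n M N) (p : N) :
    ¬ φ.IsRegularBoundaryPoint g k p := by
  rintro ⟨⟨hpc, hpr⟩, U, hpU, -, ψ, hψ, h, hext⟩
  have himage : Subtype.val '' range ψ.toFun = range φ.toFun := by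
    rw [← range_comp]
    exact congrArg range (funext hψ)
  have hp : (⟨p, hpU⟩ : U) ∈ closure (range ψ.toFun) := by
    rw [closure_subtype, himage]
    exact hpc
  obtain ⟨x, hx⟩ := hext.closure_subset_range hk hg hp
  exact hpr ⟨x, by rw [← hψ, hx]⟩
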